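/- Let $G$ be a countably infinite discrete abelian group. A *representation* of $G$ is a pair $(X,\rho)$ where $X$ is a separable infinite-dimensional complex Banach space and $\rho$ is a (continuous) homomorphism from $G$ to the group of invertible bounded linear operators on $X$. Let $\widehat G$ be the group of all (continuous) homomorphisms $\chi:G\to\mathbb T$ (characters), with trivial element $\mathbf 1$. A character $\chi$ is a *unimodular eigenvalue* of $\rho$ if there is $e\in X\setminus\{0\}$ with $\rho(g)e=\chi(g)e$ for all $g\in G$. A sequence $(g_k)_{k\ge 0}$ in $G$ is a *$G$-Jamison sequence* if every representation $(X,\rho)$ of $G$ with $\sup_{k\ge 0}\|\rho(g_k)\|<+\infty$ has at most countably many unimodular eigenvalues. Let $(g_k)_{k\ge 0}$ be a sequence of elements of $G$, and let $G_0$ be the subgroup of $G$ that it generates. 1. If the index $[G:G_0]$ is infinite, then $(g_k)_{k\ge0}$ is not a $G$-Jamison sequence. 2. Suppose that $n=[G:G_0]$ is finite. (a) One may assume without loss of generality that $G_0=G$, in the following sense. The group $G$ has systems $h_1,\dots,h_n$ of representatives of the cosets of $G_0$, and for every such system the sequence $h_1,\dots,h_n,g_0,g_1,g_2,\dots$ generates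 $G$, and it is a $G$-Jamison sequence if and only if $(g_k)_{k\ge0}$ is one. (b) If $G_0=G$, then $(g_k)_{k\ge0}$ is a $G$-Jamison sequence if and only if there exists $\varepsilon>0$ such that $$\sup_{k\ge0}|\chi(g_k)-1|\ge\varepsilon\qquad\text{for every }\chi\in\widehat G\setminus\{\mathbf 1\}.$$ -/

import Mathlib

universe u v

/-- The unimodular point spectrum `σ_p(ρ) ∩ Ĝ` of a continuous homomorphism `ρ` from `G` to the
group of invertible bounded operators on `X`: the characters `χ` of `G` for which there is
`e ≠ 0` in `X` with `ρ(g) e = χ(g) e` for every `g`. -/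
def unimodularPointSpectrum {G : Type u} [CommGroup G] [TopologicalSpace G]
    {X : Type v} [NormedAddCommGroup X] [NormedSpace ℂ X]
    (ρ : G →ₜ* (X →L[ℂ] X)ˣ) : Set (PontryaginDual G) :=
  {χ | ∃ e : X, e ≠ 0 ∧ ∀ g : G, (ρ g : X →L[ℂ] X) e = (χ g : ℂ) • e}

/-- `ρ` is partially bounded with respect to `(g_k)`: `sup_k ‖ρ(g_k)‖ < ∞`. -/
def IsPartiallyBounded {G : Type u} [CommGroup G] [TopologicalSpace G]
    {X : Type v} [NormedAddCommGroup X] [NormedSpace ℂ X]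
    (ρ : G →ₜ* (X →L[ℂ] X)ˣ) (g : ℕ → G) : Prop :=
  BddAbove (Set.range fun k : ℕ => ‖(ρ (g k) : X →L[ℂ] X)‖)

/-- `(g_k)` is a `G`-Jamison sequence: every representation of `G` on a separable
infinite-dimensional complex Banach space which is partially bounded with respect to `(g_k)` has
an at most countable unimodular point spectrum. The universe `v` of the spaces is arbitrary;
since separable Banach spaces have at most continuum many points, it does not matter. -/
def IsJamisonSequence {G : Type u} [CommGroup G] [TopologicalSpace G] (g : ℕ → G) : Prop :=
  ∀ (X : Type v) [NormedAddCommGroup X] [NormedSpace ℂ X] [CompleteSpace X]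
    [TopologicalSpace.SeparableSpace X], ¬ FiniteDimensional ℂ X →
    ∀ ρ : G →ₜ* (X →L[ℂ] X)ˣ, IsPartiallyBounded ρ g → (unimodularPointSpectrum ρ).Countable

/-- The subgroup `G₀` generated by the sequence `(g_k)`. -/
def generatedSubgroup {G : Type u} [CommGroup G] (g : ℕ → G) : Subgroup G :=
  Subgroup.closure (Set.range g)

/-- The sequence `h_0, …, h_{n-1}, g_0, g_1, g_2, …`. -/
def prependSeq {G : Type u} {n : ℕ} (h : Fin n → G) (g : ℕ → G) : ℕ → G :=
  fun k => if hk : k < n then h ⟨k, hk⟩ else g (k - n)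

/-- `h_0, …, h_{n-1}` is a system of representatives of the cosets of `H`, each coset being
represented exactly once. -/
def IsCosetSystem {G : Type u} [CommGroup G] (H : Subgroup G) {n : ℕ} (h : Fin n → G) : Prop :=
  Function.Bijective fun i => (h i : G ⧸ H)

/-!
The characters of `G` which occur as unimodular eigenvalues of a representation with
`‖ρ (g k)‖ ≤ M` have unit eigenvectors `e χ` with
`|χ (g k) - ψ (g k)| ≤ (M + 1) * ‖e χ - e ψ‖`. If every nontrivial character is at distance at
least `ε` from `1` along `g`, these vectors are uniformly separated, hence countable in number in a
separable space (`isJamisonSequence_of_forall_le_iSup`).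

Conversely, an uncountable family of characters, indexed by a separable metric space, along which
every evaluation `χ ↦ χ x` is Lipschitz, and the evaluations at the `g k` have constant `1`, gives a
counterexample to the Jamison property (`not_isJamisonSequence_of_lipschitz`). The
best Lipschitz constant `ℓ x` is subadditive in `x`, so `W = 1 + ℓ` is a submultiplicative weight
on `G`. The group acts by translations on the functions `F` with `F / W` bounded, the translation by
`x` having norm at most `W x`, and `W (g k) ≤ 2`. Every character is an eigenvector there, and the
vectors of the family depend on the index in a Lipschitz way, because the weight absorbs the
Lipschitz constants. So they span a separable invariant subspace.

Such families come from distances `d χ ψ = sup_k c k * |χ (γ k) - ψ (γ k)|`, where `γ` generates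
`G` and `0 < c ≤ 1`. They are complete and invariant under multiplication, so if `1` is not isolated
in the group of characters trivial on a subgroup `H`, this group is perfect and contains a Cantor
set (`not_isJamisonSequence_of_accPt`). If `g` generates `G`, take `γ = g`, `c = 1` and `H`
trivial: the failure of the `ε`-condition says exactly that `1` is not isolated. If `g` generates a
subgroup `H` of infinite index, the representation is built from characters trivial on `H`: these
form an infinite compact group for pointwise convergence, which is not discrete, and pointwise
convergence is described by the choice of an enumeration `γ` of `G` and `c k = 2 ^ (-k)`.

For a subgroup of finite index, adding finitely many elements to a sequence does not change which
representations are bounded along it.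
-/

open Set BoundedContinuousFunction

/-! ### Characters of a discrete abelian group -/

/-- The characters of `G` which are trivial on `H`. -/
def dualAnnihilator {G : Type u} [CommGroup G] [TopologicalSpace G] (H : Subgroup G) :
    Subgroup (PontryaginDual G) where
  carrier := {χ | ∀ h ∈ H, χ h = 1}
  one_mem' _ _ := rfl
  mul_mem' {χ ψ} hχ hψ h hh := by
    change χ h * ψ h = 1
    rw [hχ h hh, hψ h hh, one_mul]
  inv_mem' {χ} hχ h hh := by
    change (χ h)⁻¹ = 1
    rw [hχ h hh, inv_one]

theorem PontryaginDual.continuous_eval {G : Type u} [CommGroup G] [TopologicalSpace G] (x : G) :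
    Continuous fun χ : PontryaginDual G => χ x :=
  (ContinuousMonoidHom.isInducing_toContinuousMap G Circle).continuous.eval_const x

theorem PontryaginDual.pow_apply {G : Type u} [CommGroup G] [TopologicalSpace G]
    (χ : PontryaginDual G) (n : ℕ) (x : G) : (χ ^ n) x = χ x ^ n := by
  induction n with
  | zero => rw [pow_zero, pow_zero, PontryaginDual.one_apply]
  | succ n ih =>
    rw [pow_succ, pow_succ, ← ih]
    rfl

theorem PontryaginDual.norm_coe_sub_one {G : Type u} [CommGroup G] [TopologicalSpace G]
    (χ ψ : PontryaginDual G) (x : G) :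
    ‖(((ψ⁻¹ * χ : PontryaginDual G) x : Circle) : ℂ) - 1‖ = ‖(χ x : ℂ) - (ψ x : ℂ)‖ := by
  have h : (((ψ⁻¹ * χ : PontryaginDual G) x : Circle) : ℂ) = ((ψ x)⁻¹ * χ x : Circle) := rfl
  have h1 : (χ x : ℂ) - (ψ x : ℂ) = (ψ x : ℂ) * ((((ψ x)⁻¹ * χ x : Circle) : ℂ) - 1) := by
    rw [mul_sub, ← Circle.coe_mul, mul_inv_cancel_left, mul_one]
  rw [h, h1, norm_mul, Circle.norm_coe, one_mul]

theorem PontryaginDual.norm_sub_one_le {G : Type u} [CommGroup G] [TopologicalSpace G]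
    (χ : PontryaginDual G) (x : G) : ‖(χ x : ℂ) - 1‖ ≤ 2 := by
  refine (norm_sub_le _ _).trans (le_of_eq ?_)
  rw [Circle.norm_coe, norm_one, one_add_one_eq_two]

theorem isClosed_dualAnnihilator {G : Type u} [CommGroup G] [TopologicalSpace G]
    (H : Subgroup G) : IsClosed (dualAnnihilator H : Set (PontryaginDual G)) := by
  have : (dualAnnihilator H : Set (PontryaginDual G)) = ⋂ h ∈ H, {χ | χ h = 1} := by
    ext χ
    simp only [mem_iInter, mem_ofPred_eq]
    rfl
  rw [this]
  exact isClosed_biInter fun h _ =>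
    isClosed_eq (PontryaginDual.continuous_eval h) continuous_const

/-- The standard embedding of `ℚ/ℤ` into the circle group. -/
noncomputable def ratAddCircleToCircle : AddCircle (1 : ℚ) →+ Additive Circle :=
  QuotientAddGroup.lift _
    (AddMonoidHom.mk' (fun x : ℚ =>
        Additive.ofMul (AddCircle.toCircle ((x : ℝ) : AddCircle (1 : ℝ))))
      (fun a b => by
        rw [Rat.cast_add, AddCircle.coe_add, AddCircle.toCircle_add]; rfl))
    (by
      intro x hx
      obtain ⟨n, rfl⟩ := AddSubgroup.mem_zmultiples_iff.1 hx
      rw [AddMonoidHom.mem_ker]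
      have : (((n • (1 : ℚ) : ℚ) : ℝ) : AddCircle (1 : ℝ)) = 0 := by
        rw [AddCircle.coe_eq_zero_iff]
        exact ⟨n, by simp⟩
      change Additive.ofMul (AddCircle.toCircle (((n • (1 : ℚ) : ℚ) : ℝ) : AddCircle (1 : ℝ))) = 0
      rw [this, AddCircle.toCircle_zero]
      rfl)

theorem ratAddCircleToCircle_injective : Function.Injective ratAddCircleToCircle := by
  rw [injective_iff_map_eq_zero]
  intro a ha
  induction a using QuotientAddGroup.induction_on with
  | H x =>
    have h : AddCircle.toCircle ((x : ℝ) : AddCircle (1 : ℝ)) = 1 := ha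
    have h' := AddCircle.injective_toCircle one_ne_zero (h.trans AddCircle.toCircle_zero.symm)
    rw [AddCircle.coe_eq_zero_iff] at h'
    obtain ⟨n, hn⟩ := h'
    refine (AddCircle.coe_eq_zero_iff (1 : ℚ)).2 ⟨n, ?_⟩
    have : (n : ℝ) = (x : ℝ) := by simpa using hn
    have : (n : ℚ) = x := by exact_mod_cast this
    simpa using this

/-- Characters separate a subgroup of a discrete abelian group from the points outside it. -/
theorem exists_mem_dualAnnihilator_apply_ne_one {G : Type u} [CommGroup G] [TopologicalSpace G]
    [DiscreteTopology G] {H : Subgroup G} {x : G} (hx : x ∉ H) :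
    ∃ χ ∈ dualAnnihilator H, χ x ≠ 1 := by
  have hne : Additive.ofMul (x : G ⧸ H) ≠ 0 := by
    intro h
    exact hx ((QuotientGroup.eq_one_iff x).1 h)
  obtain ⟨c, hc⟩ := CharacterModule.exists_character_apply_ne_zero_of_ne_zero hne
  let f : G →* Circle :=
    (AddMonoidHom.toMultiplicative
      (ratAddCircleToCircle.comp (c : Additive (G ⧸ H) →+ AddCircle (1 : ℚ)))).comp
        (QuotientGroup.mk' H)
  refine ⟨(⟨f, continuous_of_discreteTopology⟩ : G →ₜ* Circle), fun h hh => ?_, fun h => hc ?_⟩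
  · have h0 : Additive.ofMul (h : G ⧸ H) = 0 := (QuotientGroup.eq_one_iff h).2 hh
    change ratAddCircleToCircle (c (Additive.ofMul (h : G ⧸ H))) = 0
    rw [h0, map_zero, map_zero]
  · refine (map_eq_zero_iff _ ratAddCircleToCircle_injective).1 ?_
    exact h

/-- If a subgroup has infinite index, then infinitely many characters are trivial on it: were
there only `n` of them, their values would be `n`-th roots of unity, and they would separate the
points of the quotient. -/
theorem infinite_dualAnnihilator {G : Type u} [CommGroup G] [TopologicalSpace G]
    [DiscreteTopology G] (H : Subgroup G) [Infinite (G ⧸ H)] : Infinite (dualAnnihilator H) := by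
  by_contra hfin
  rw [not_infinite_iff_finite] at hfin
  set n := Nat.card (dualAnnihilator H) with hn
  have hn0 : n ≠ 0 := Nat.card_ne_zero.2 ⟨⟨1⟩, hfin⟩
  have hroots : {z : Circle | z ^ n = 1}.Finite := by
    refine Set.Finite.of_finite_image (f := fun z : Circle => (z : ℂ)) ?_ Circle.coe_injective.injOn
    refine (Multiset.finite_toSet (Polynomial.nthRoots n (1 : ℂ))).subset ?_
    rintro _ ⟨z, hz, rfl⟩
    refine (Polynomial.mem_nthRoots (Nat.pos_of_ne_zero hn0)).2 ?_
    rw [← Circle.coe_pow, hz, Circle.coe_one]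
  have hpi : {φ : dualAnnihilator H → Circle | ∀ χ, φ χ ^ n = 1}.Finite :=
    Set.Finite.pi' fun _ => hroots
  let F : G ⧸ H → (dualAnnihilator H → Circle) := fun q χ => (χ : PontryaginDual G) q.out
  have hF : Function.Injective F := by
    intro p q hpq
    by_contra hne
    have : p.out⁻¹ * q.out ∉ H := fun h => hne (by
      have := QuotientGroup.eq.2 h
      simpa using this)
    obtain ⟨χ, hχ, hχ1⟩ := exists_mem_dualAnnihilator_apply_ne_one this
    refine hχ1 ?_
    have h : χ p.out = χ q.out := congrFun hpq ⟨χ, hχ⟩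
    rw [map_mul, map_inv, h, inv_mul_cancel]
  have hmaps : ∀ q, F q ∈ {φ : dualAnnihilator H → Circle | ∀ χ, φ χ ^ n = 1} := by
    intro q χ
    have h : χ ^ n = 1 := pow_card_eq_one'
    have h' : ((χ : PontryaginDual G) ^ n) = 1 := by exact_mod_cast congrArg Subtype.val h
    have h2 := congrArg (fun ψ : PontryaginDual G => ψ q.out) h'
    rwa [PontryaginDual.pow_apply] at h2
  exact Set.infinite_of_injective_forall_mem hF hmaps hpi

/-- If a subgroup has infinite index, then the trivial character is an accumulation point, for
pointwise convergence, of the characters which are trivial on it. -/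
theorem exists_mem_dualAnnihilator_forall_norm_lt {G : Type u} [CommGroup G] [TopologicalSpace G]
    [DiscreteTopology G] (H : Subgroup G) [Infinite (G ⧸ H)] (s : Finset G) {ε : ℝ} (hε : 0 < ε) :
    ∃ χ ∈ dualAnnihilator H, χ ≠ 1 ∧ ∀ x ∈ s, ‖(χ x : ℂ) - 1‖ < ε := by
  by_contra! hcon
  have := infinite_dualAnnihilator H
  have : CompactSpace (dualAnnihilator H) :=
    isCompact_iff_compactSpace.1 (isClosed_dualAnnihilator H).isCompact
  -- Otherwise this group is discrete; being compact, it is then finite.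
  have hopen : IsOpen ({1} : Set (dualAnnihilator H)) := by
    have h1 : ({1} : Set (dualAnnihilator H)) =
        ⋂ x ∈ s, {χ : dualAnnihilator H | ‖((χ : PontryaginDual G) x : ℂ) - 1‖ < ε} := by
      ext χ
      simp only [mem_singleton_iff, mem_iInter, mem_ofPred_eq]
      refine ⟨?_, fun h => ?_⟩
      · rintro rfl x _
        simpa using hε
      · by_contra hne
        obtain ⟨x, hx, hx'⟩ := hcon χ χ.2 (fun h => hne (Subtype.ext h))
        exact absurd (h x hx) (not_lt.2 hx')
    rw [h1]
    refine isOpen_biInter_finset fun x _ => isOpen_lt ?_ continuous_const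
    have := (PontryaginDual.continuous_eval x).comp
      (continuous_subtype_val (p := fun χ => χ ∈ dualAnnihilator H))
    exact ((continuous_subtype_val.comp this).sub continuous_const).norm
  have := discreteTopology_of_isOpen_singleton_one hopen
  exact not_finite_iff_infinite.2 ‹_› finite_of_compact_of_discrete

/-! ### Weighted translations of bounded functions -/

section WeightedTranslation

variable {G : Type u} [CommGroup G] {I : Type v} [TopologicalSpace I]

theorem norm_weighted_translate_le {W : G → ℝ} (hW1 : ∀ x, 1 ≤ W x)
    (hW : ∀ x y, W (x * y) ≤ W x * W y) (e : I ≃ G) (x : G) (φ : I →ᵇ ℂ) (i : I) :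
    ‖((W (x * e i) / W (e i) : ℝ) : ℂ) * φ (e.symm (x * e i))‖ ≤ W x * ‖φ‖ := by
  have hpos : ∀ y, 0 < W y := fun y => zero_lt_one.trans_le (hW1 y)
  rw [norm_mul, Complex.norm_real, Real.norm_of_nonneg (div_nonneg (hpos _).le (hpos _).le)]
  refine mul_le_mul ?_ (φ.norm_coe_le_norm _) (norm_nonneg _) (hpos x).le
  rw [div_le_iff₀ (hpos _)]
  exact hW x (e i)

variable [DiscreteTopology I]

/-- The action of `G` by translations on the functions `F` on `G` with `F / W` bounded, where
`W ≥ 1` is a submultiplicative weight. The function `F` is encoded by `φ = F / W`, which turns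
the space into the space of bounded functions, and the translations into weighted ones. The
points of `G` are labelled by `I`, so that the space can live in any universe. -/
noncomputable def weightedTranslation {W : G → ℝ} (hW1 : ∀ x, 1 ≤ W x)
    (hW : ∀ x y, W (x * y) ≤ W x * W y) (e : I ≃ G) : G →* ((I →ᵇ ℂ) →L[ℂ] (I →ᵇ ℂ)) where
  toFun x := LinearMap.mkContinuous
    { toFun := fun φ => ofNormedAddCommGroupDiscrete
        (fun i => ((W (x * e i) / W (e i) : ℝ) : ℂ) * φ (e.symm (x * e i))) (W x * ‖φ‖)
        (norm_weighted_translate_le hW1 hW e x φ)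
      map_add' := fun φ ψ => by
        ext i
        simp [mul_add]
      map_smul' := fun c φ => by
        ext i
        simp [mul_left_comm] }
    (W x) fun φ => norm_ofNormedAddCommGroup_le _
      (mul_nonneg (zero_le_one.trans (hW1 x)) (norm_nonneg φ))
      (norm_weighted_translate_le hW1 hW e x φ)
  map_one' := by
    ext φ i
    have : W (e i) ≠ 0 := (zero_lt_one.trans_le (hW1 _)).ne'
    simp [this]
  map_mul' x y := by
    ext φ i
    have h : ((W (x * e i) : ℝ) : ℂ) ≠ 0 :=
      Complex.ofReal_ne_zero.2 (zero_lt_one.trans_le (hW1 _)).ne'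
    simp only [LinearMap.mkContinuous_apply, LinearMap.coe_mk, AddHom.coe_mk,
      coe_ofNormedAddCommGroupDiscrete, mul_apply_eq_comp, Equiv.apply_symm_apply,
      Complex.ofReal_div]
    rw [mul_comm x y, mul_assoc y x (e i)]
    field_simp

theorem weightedTranslation_apply {W : G → ℝ} (hW1 : ∀ x, 1 ≤ W x)
    (hW : ∀ x y, W (x * y) ≤ W x * W y) (e : I ≃ G) (x : G) (φ : I →ᵇ ℂ) (i : I) :
    weightedTranslation hW1 hW e x φ i =
      ((W (x * e i) / W (e i) : ℝ) : ℂ) * φ (e.symm (x * e i)) := rfl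

theorem norm_weightedTranslation_le {W : G → ℝ} (hW1 : ∀ x, 1 ≤ W x)
    (hW : ∀ x y, W (x * y) ≤ W x * W y) (e : I ≃ G) (x : G) :
    ‖weightedTranslation hW1 hW e x‖ ≤ W x :=
  ContinuousLinearMap.opNorm_le_bound _ (zero_le_one.trans (hW1 x)) fun φ =>
    norm_ofNormedAddCommGroup_le _ (mul_nonneg (zero_le_one.trans (hW1 x)) (norm_nonneg φ))
      (norm_weighted_translate_le hW1 hW e x φ)

variable [TopologicalSpace G]

/-- The character `χ`, as a vector of the space on which `weightedTranslation` acts. -/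
noncomputable def weightedCharacter {W : G → ℝ} (hW1 : ∀ x, 1 ≤ W x) (e : I ≃ G)
    (χ : PontryaginDual G) : I →ᵇ ℂ :=
  ofNormedAddCommGroupDiscrete (fun i => (χ (e i) : ℂ) / (W (e i) : ℂ)) 1 fun i => by
    rw [norm_div, Circle.norm_coe, Complex.norm_real,
      Real.norm_of_nonneg (zero_le_one.trans (hW1 _))]
    exact div_le_one_of_le₀ (hW1 _) (zero_le_one.trans (hW1 _))

theorem weightedCharacter_apply {W : G → ℝ} (hW1 : ∀ x, 1 ≤ W x) (e : I ≃ G)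
    (χ : PontryaginDual G) (i : I) :
    weightedCharacter hW1 e χ i = (χ (e i) : ℂ) / (W (e i) : ℂ) := rfl

theorem weightedTranslation_weightedCharacter {W : G → ℝ} (hW1 : ∀ x, 1 ≤ W x)
    (hW : ∀ x y, W (x * y) ≤ W x * W y) (e : I ≃ G) (x : G) (χ : PontryaginDual G) :
    weightedTranslation hW1 hW e x (weightedCharacter hW1 e χ) =
      (χ x : ℂ) • weightedCharacter hW1 e χ := by
  ext i
  have h : ((W (x * e i) : ℝ) : ℂ) ≠ 0 :=
    Complex.ofReal_ne_zero.2 (zero_lt_one.trans_le (hW1 _)).ne'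
  change _ = (χ x : ℂ) * weightedCharacter hW1 e χ i
  rw [weightedTranslation_apply, weightedCharacter_apply, Equiv.apply_symm_apply,
    weightedCharacter_apply, map_mul, Circle.coe_mul, Complex.ofReal_div]
  field_simp

theorem dist_weightedCharacter_le {W : G → ℝ} (hW1 : ∀ x, 1 ≤ W x) (e : I ≃ G)
    {χ ψ : PontryaginDual G} {C : ℝ} (hC : 0 ≤ C)
    (h : ∀ x, ‖(χ x : ℂ) - (ψ x : ℂ)‖ ≤ W x * C) :
    dist (weightedCharacter hW1 e χ) (weightedCharacter hW1 e ψ) ≤ C := by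
  refine (dist_le hC).2 fun i => ?_
  have hpos : 0 < W (e i) := zero_lt_one.trans_le (hW1 _)
  rw [weightedCharacter_apply, weightedCharacter_apply, dist_eq_norm, ← sub_div, norm_div,
    Complex.norm_real, Real.norm_of_nonneg hpos.le, div_le_iff₀ hpos, mul_comm C]
  exact h (e i)

theorem linearIndependent_weightedCharacter {W : G → ℝ} (hW1 : ∀ x, 1 ≤ W x) (e : I ≃ G) :
    LinearIndependent ℂ (weightedCharacter (G := G) hW1 e) := by
  let T : (I →ᵇ ℂ) →ₗ[ℂ] (G → ℂ) :=
    { toFun := fun φ x => (W x : ℂ) * φ (e.symm x)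
      map_add' := fun φ ψ => by
        ext x
        simp [mul_add]
      map_smul' := fun c φ => by
        ext x
        simp [mul_left_comm] }
  let F : PontryaginDual G → (G →* ℂ) := fun χ =>
    Circle.coeHom.comp (MonoidHomClass.toMonoidHom χ)
  have hF : Function.Injective F := fun χ ψ h =>
    PontryaginDual.ext fun x => Circle.coe_injective (DFunLike.congr_fun h x)
  refine LinearIndependent.of_comp T ?_
  have hT : T ∘ weightedCharacter hW1 e = (fun f : G →* ℂ => (f : G → ℂ)) ∘ F := by
    ext χ x
    have h : ((W x : ℝ) : ℂ) ≠ 0 :=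
      Complex.ofReal_ne_zero.2 (zero_lt_one.trans_le (hW1 _)).ne'
    change (W x : ℂ) * weightedCharacter hW1 e χ (e.symm x) = (χ x : ℂ)
    rw [weightedCharacter_apply, Equiv.apply_symm_apply]
    field_simp
  rw [hT]
  exact (linearIndependent_monoidHom G ℂ).comp F hF

end WeightedTranslation

/-! ### Lipschitz families of characters -/

/-- The best Lipschitz constant of the evaluation at `x` along a family of characters indexed by a
metric space. -/
noncomputable def evalLipschitzConst {G : Type u} [CommGroup G] [TopologicalSpace G] {Y : Type*}
    [MetricSpace Y] (f : Y → PontryaginDual G) (x : G) : ℝ :=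
  ⨆ p : Y × Y, ‖(f p.1 x : ℂ) - (f p.2 x : ℂ)‖ / dist p.1 p.2

section Lipschitz

variable {G : Type u} [CommGroup G] [TopologicalSpace G] {Y : Type*} [MetricSpace Y]
  {f : Y → PontryaginDual G}

theorem evalLipschitzConst_nonneg (x : G) : 0 ≤ evalLipschitzConst f x :=
  Real.iSup_nonneg fun _ => div_nonneg (norm_nonneg _) dist_nonneg

theorem evalLipschitzConst_le {x : G} {L : ℝ} (hL : 0 ≤ L)
    (h : ∀ y z, ‖(f y x : ℂ) - (f z x : ℂ)‖ ≤ L * dist y z) : evalLipschitzConst f x ≤ L :=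
  Real.iSup_le (fun p => div_le_of_le_mul₀ dist_nonneg hL (h p.1 p.2)) hL

theorem norm_eval_sub_le {x : G}
    (hx : ∃ L, 0 ≤ L ∧ ∀ y z, ‖(f y x : ℂ) - (f z x : ℂ)‖ ≤ L * dist y z) (y z : Y) :
    ‖(f y x : ℂ) - (f z x : ℂ)‖ ≤ evalLipschitzConst f x * dist y z := by
  obtain ⟨L, hL, h⟩ := hx
  rcases eq_or_ne y z with rfl | hyz
  · simp
  · rw [← div_le_iff₀ (dist_pos.2 hyz)]
    refine le_ciSup (f := fun p : Y × Y => ‖(f p.1 x : ℂ) - (f p.2 x : ℂ)‖ / dist p.1 p.2)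
      ⟨L, ?_⟩ (y, z)
    rintro _ ⟨p, rfl⟩
    exact div_le_of_le_mul₀ dist_nonneg hL (h p.1 p.2)

theorem norm_eval_mul_sub_le (χ ψ : PontryaginDual G) (x y : G) :
    ‖(χ (x * y) : ℂ) - (ψ (x * y) : ℂ)‖ ≤
      ‖(χ x : ℂ) - (ψ x : ℂ)‖ + ‖(χ y : ℂ) - (ψ y : ℂ)‖ := by
  have h : (χ (x * y) : ℂ) - (ψ (x * y) : ℂ) =
      ((χ x : ℂ) - (ψ x : ℂ)) * (χ y : ℂ) + (ψ x : ℂ) * ((χ y : ℂ) - (ψ y : ℂ)) := by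
    rw [map_mul, map_mul, Circle.coe_mul, Circle.coe_mul]
    ring
  rw [h]
  refine (norm_add_le _ _).trans (le_of_eq ?_)
  rw [norm_mul, norm_mul, Circle.norm_coe, Circle.norm_coe, mul_one, one_mul]

theorem norm_eval_inv_sub (χ ψ : PontryaginDual G) (x : G) :
    ‖(χ x⁻¹ : ℂ) - (ψ x⁻¹ : ℂ)‖ = ‖(χ x : ℂ) - (ψ x : ℂ)‖ := by
  rw [map_inv, map_inv, Circle.coe_inv_eq_conj, Circle.coe_inv_eq_conj, ← map_sub,
    RCLike.norm_conj]

/-- The elements of `G` at which evaluation is Lipschitz form a subgroup, so that it suffices to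
look at generators. -/
theorem exists_lipschitz_of_closure_eq_top {γ : ℕ → G} (hγ : Subgroup.closure (range γ) = ⊤)
    (h : ∀ k, ∃ L, 0 ≤ L ∧ ∀ y z, ‖(f y (γ k) : ℂ) - (f z (γ k) : ℂ)‖ ≤ L * dist y z) (x : G) :
    ∃ L, 0 ≤ L ∧ ∀ y z, ‖(f y x : ℂ) - (f z x : ℂ)‖ ≤ L * dist y z := by
  have hx : x ∈ Subgroup.closure (range γ) := hγ ▸ Subgroup.mem_top x
  induction hx using Subgroup.closure_induction with
  | mem x hx =>
    obtain ⟨k, rfl⟩ := hx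
    exact h k
  | one => exact ⟨0, le_rfl, fun y z => by simp⟩
  | mul a b _ _ ha hb =>
    obtain ⟨L, hL, hLa⟩ := ha
    obtain ⟨M, hM, hMb⟩ := hb
    refine ⟨L + M, add_nonneg hL hM, fun y z => (norm_eval_mul_sub_le _ _ _ _).trans ?_⟩
    rw [add_mul]
    exact add_le_add (hLa y z) (hMb y z)
  | inv a _ ha =>
    obtain ⟨L, hL, hLa⟩ := ha
    exact ⟨L, hL, fun y z => (norm_eval_inv_sub _ _ _).trans_le (hLa y z)⟩

/-- An uncountable family of characters, indexed by a separable metric space, along which all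
evaluations are Lipschitz, those at the `g k` with constant `1`, defeats the Jamison property of
`g`: the characters of the family are eigenvectors of the translations on the functions of growth
`O(1 + ℓ)`, where `ℓ x` is the Lipschitz constant of the evaluation at `x`, and they span a
separable space. -/
theorem not_isJamisonSequence_of_lipschitz [DiscreteTopology G] [Countable G] [Infinite G]
    [TopologicalSpace.SeparableSpace Y] [Uncountable Y] (hf : Function.Injective f)
    (hlip : ∀ x, ∃ L, 0 ≤ L ∧ ∀ y z, ‖(f y x : ℂ) - (f z x : ℂ)‖ ≤ L * dist y z) {g : ℕ → G}
    (hg : ∀ k y z, ‖(f y (g k) : ℂ) - (f z (g k) : ℂ)‖ ≤ dist y z) :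
    ¬ IsJamisonSequence.{u, v} g := by
  let W : G → ℝ := fun x => 1 + evalLipschitzConst f x
  have hW1 : ∀ x, 1 ≤ W x := fun x => le_add_of_nonneg_right (evalLipschitzConst_nonneg x)
  have hW : ∀ x y, W (x * y) ≤ W x * W y := by
    intro x y
    have h : evalLipschitzConst f (x * y) ≤ evalLipschitzConst f x + evalLipschitzConst f y :=
      evalLipschitzConst_le
        (add_nonneg (evalLipschitzConst_nonneg x) (evalLipschitzConst_nonneg y)) fun a b => by
          rw [add_mul]
          exact (norm_eval_mul_sub_le _ _ _ _).trans
            (add_le_add (norm_eval_sub_le (hlip x) a b) (norm_eval_sub_le (hlip y) a b))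
    have h' := mul_nonneg (evalLipschitzConst_nonneg (f := f) x)
      (evalLipschitzConst_nonneg (f := f) y)
    simp only [W]
    nlinarith
  obtain ⟨e₀⟩ : Nonempty (ℕ ≃ G) := nonempty_equiv_of_countable
  -- The space has to live in the universe `v`, whatever the universe of `G` is.
  let e : ULift.{v} ℕ ≃ G := Equiv.ulift.trans e₀
  let w : Y → (ULift.{v} ℕ →ᵇ ℂ) := fun y => weightedCharacter hW1 e (f y)
  have hw : LinearIndependent ℂ w := (linearIndependent_weightedCharacter hW1 e).comp f hf
  let X : Submodule ℂ (ULift.{v} ℕ →ᵇ ℂ) := (Submodule.span ℂ (range w)).topologicalClosure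
  have hwX : ∀ y, w y ∈ X := fun y =>
    Submodule.le_topologicalClosure _ (Submodule.subset_span (mem_range_self y))
  have hcont : Continuous w := by
    refine (LipschitzWith.of_dist_le_mul (K := 1) fun y z => ?_).continuous
    rw [NNReal.coe_one, one_mul]
    refine dist_weightedCharacter_le hW1 e dist_nonneg fun x => ?_
    refine (norm_eval_sub_le (hlip x) y z).trans ?_
    exact mul_le_mul_of_nonneg_right (le_add_of_nonneg_left zero_le_one) dist_nonneg
  have hinv : ∀ x, ∀ φ ∈ X, weightedTranslation hW1 hW e x φ ∈ X := by
    intro x φ hφ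
    have hmaps : MapsTo (weightedTranslation hW1 hW e x)
        (Submodule.span ℂ (range w) : Set (ULift.{v} ℕ →ᵇ ℂ)) (Submodule.span ℂ (range w)) := by
      intro ψ hψ
      induction hψ using Submodule.span_induction with
      | mem ψ hψ =>
        obtain ⟨y, rfl⟩ := hψ
        change weightedTranslation hW1 hW e x (weightedCharacter hW1 e (f y)) ∈ _
        rw [weightedTranslation_weightedCharacter]
        exact Submodule.smul_mem _ _ (Submodule.subset_span (mem_range_self y))
      | zero => rw [map_zero]; exact Submodule.zero_mem _
      | add a b _ _ ha hb => rw [map_add]; exact Submodule.add_mem _ ha hb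
      | smul c a _ ha => rw [map_smul]; exact Submodule.smul_mem _ _ ha
    exact hmaps.closure (weightedTranslation hW1 hW e x).continuous hφ
  have hXc : CompleteSpace X := (Submodule.isClosed_topologicalClosure _).completeSpace_coe
  have hXs : TopologicalSpace.SeparableSpace X :=
    ((TopologicalSpace.isSeparable_range hcont).span (R := ℂ)).closure.separableSpace
  have hXi : ¬ FiniteDimensional ℂ X := by
    intro hfin
    have hw' : LinearIndependent ℂ (fun y => (⟨w y, hwX y⟩ : X)) :=
      LinearIndependent.of_comp X.subtype hw
    exact not_finite_iff_infinite.2 inferInstance hw'.finite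
  let τ : G →* (X →L[ℂ] X) :=
    { toFun := fun x => (weightedTranslation hW1 hW e x).restrict (hinv x)
      map_one' := by
        ext1 φ
        apply Subtype.ext
        rw [ContinuousLinearMap.coe_restrict_apply, map_one]
        rfl
      map_mul' := fun x y => by
        ext1 φ
        apply Subtype.ext
        rw [ContinuousLinearMap.coe_restrict_apply, map_mul]
        rfl }
  let ρ : G →ₜ* (X →L[ℂ] X)ˣ := ⟨τ.toHomUnits, continuous_of_discreteTopology⟩
  have hρ : IsPartiallyBounded ρ g := by
    refine ⟨2, ?_⟩
    rintro _ ⟨k, rfl⟩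
    refine ContinuousLinearMap.opNorm_le_bound _ zero_le_two fun φ => ?_
    have hk : W (g k) ≤ 2 := by
      have := evalLipschitzConst_le (f := f) (x := g k) zero_le_one fun y z => by
        rw [one_mul]
        exact hg k y z
      simp only [W]
      linarith
    exact (ContinuousLinearMap.le_of_opNorm_le _
      ((norm_weightedTranslation_le hW1 hW e (g k)).trans hk) (φ : ULift.{v} ℕ →ᵇ ℂ))
  intro hJ
  have hcount := hJ X hXi ρ hρ
  have hsub : range f ⊆ unimodularPointSpectrum ρ := by
    rintro _ ⟨y, rfl⟩
    refine ⟨⟨w y, hwX y⟩, fun h => hw.ne_zero y (congrArg Subtype.val h), fun x => ?_⟩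
    exact Subtype.ext (weightedTranslation_weightedCharacter hW1 hW e x (f y))
  have : Countable (range f) := (hcount.mono hsub).to_subtype
  exact not_countable ((Equiv.ofInjective f hf).injective.countable)

end Lipschitz

/-! ### Cantor sets of characters -/

section CantorSet

variable {G : Type u} [CommGroup G] [TopologicalSpace G]

/-- The scaled values `c k * χ (γ k)` of a character at the points of a sequence `γ`, as a bounded
sequence. For `γ` generating and `c > 0`, this embeds the dual group into `ℓ^∞`; the metric it
induces there is invariant under multiplication of characters. -/
noncomputable def characterValues (γ : ℕ → G) {c : ℕ → ℝ} (hc0 : ∀ k, 0 < c k)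
    (hc1 : ∀ k, c k ≤ 1) (χ : PontryaginDual G) : ℕ →ᵇ ℂ :=
  ofNormedAddCommGroupDiscrete (fun k => (c k : ℂ) * (χ (γ k) : ℂ)) 1 fun k => by
    rw [norm_mul, Circle.norm_coe, Complex.norm_real, Real.norm_of_nonneg (hc0 k).le, mul_one]
    exact hc1 k

theorem characterValues_apply (γ : ℕ → G) {c : ℕ → ℝ} (hc0 : ∀ k, 0 < c k)
    (hc1 : ∀ k, c k ≤ 1) (χ : PontryaginDual G) (k : ℕ) :
    characterValues γ hc0 hc1 χ k = (c k : ℂ) * (χ (γ k) : ℂ) := rfl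

theorem dist_characterValues_apply (γ : ℕ → G) {c : ℕ → ℝ} (hc0 : ∀ k, 0 < c k)
    (hc1 : ∀ k, c k ≤ 1) (χ ψ : PontryaginDual G) (k : ℕ) :
    dist (characterValues γ hc0 hc1 χ k) (characterValues γ hc0 hc1 ψ k) =
      c k * ‖(χ (γ k) : ℂ) - (ψ (γ k) : ℂ)‖ := by
  rw [characterValues_apply, characterValues_apply, dist_eq_norm, ← mul_sub, norm_mul,
    Complex.norm_real, Real.norm_of_nonneg (hc0 k).le]

theorem characterValues_injective {γ : ℕ → G} (hγ : Subgroup.closure (range γ) = ⊤) {c : ℕ → ℝ}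
    (hc0 : ∀ k, 0 < c k) (hc1 : ∀ k, c k ≤ 1) :
    Function.Injective (characterValues γ hc0 hc1) := by
  intro χ ψ h
  have hgen : Set.EqOn (MonoidHomClass.toMonoidHom χ) (MonoidHomClass.toMonoidHom ψ)
      (range γ) := by
    rintro _ ⟨k, rfl⟩
    have hk : (c k : ℂ) * (χ (γ k) : ℂ) = (c k : ℂ) * (ψ (γ k) : ℂ) := DFunLike.congr_fun h k
    exact Circle.coe_injective
      (mul_left_cancel₀ (Complex.ofReal_ne_zero.2 (hc0 k).ne') hk)
  have := MonoidHom.eq_of_eqOn_dense hγ hgen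
  exact PontryaginDual.ext fun x => DFunLike.congr_fun this x

/-- The image of a closed set of characters is closed in `ℓ^∞`: its image is even compact for
pointwise convergence. -/
theorem isClosed_image_characterValues [DiscreteTopology G] (γ : ℕ → G) {c : ℕ → ℝ}
    (hc0 : ∀ k, 0 < c k) (hc1 : ∀ k, c k ≤ 1) {A : Set (PontryaginDual G)} (hA : IsClosed A) :
    IsClosed (characterValues γ hc0 hc1 '' A) := by
  have hcont : Continuous fun χ : PontryaginDual G =>
      (characterValues γ hc0 hc1 χ : ℕ → ℂ) :=
    continuous_pi fun k =>
      continuous_const.mul (continuous_subtype_val.comp (PontryaginDual.continuous_eval (γ k)))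
  -- By injectivity of the coercion to functions, the image is a preimage of the pointwise one.
  have himage : characterValues γ hc0 hc1 '' A = (fun φ : ℕ →ᵇ ℂ => (φ : ℕ → ℂ)) ⁻¹'
      ((fun χ : PontryaginDual G => (characterValues γ hc0 hc1 χ : ℕ → ℂ)) '' A) := by
    rw [← image_image (fun φ : ℕ →ᵇ ℂ => (φ : ℕ → ℂ)),
      preimage_image_eq _ DFunLike.coe_injective]
  rw [himage]
  exact (hA.isCompact.image hcont).isClosed.preimage continuous_coe

/-- If the trivial character is an accumulation point of the characters trivial on `H`, for the
distance `sup_k c k * |χ (γ k) - ψ (γ k)|`, then these characters form a perfect complete metric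
space. A Cantor set in it is an uncountable family to which
`not_isJamisonSequence_of_lipschitz` applies. -/
theorem not_isJamisonSequence_of_accPt [DiscreteTopology G] [Countable G] [Infinite G]
    (H : Subgroup G) {γ : ℕ → G} (hγ : Subgroup.closure (range γ) = ⊤) {c : ℕ → ℝ}
    (hc0 : ∀ k, 0 < c k) (hc1 : ∀ k, c k ≤ 1)
    (hacc : ∀ ε > 0, ∃ χ ∈ dualAnnihilator H, χ ≠ 1 ∧ ∀ k, c k * ‖(χ (γ k) : ℂ) - 1‖ ≤ ε)
    {g : ℕ → G} (hg : ∀ k, g k ∈ H ∨ ∃ j, g k = γ j ∧ c j = 1) :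
    ¬ IsJamisonSequence.{u, v} g := by
  set Ψ := characterValues γ hc0 hc1
  have hinj : Function.Injective Ψ := characterValues_injective hγ hc0 hc1
  have hperf : Perfect (Ψ '' dualAnnihilator H) := by
    refine ⟨isClosed_image_characterValues γ hc0 hc1 (isClosed_dualAnnihilator H), ?_⟩
    rw [preperfect_iff_nhds]
    rintro _ ⟨ψ, hψ, rfl⟩ U hU
    obtain ⟨ε, hε, hεU⟩ := Metric.mem_nhds_iff.1 hU
    obtain ⟨χ, hχ, hχ1, hχε⟩ := hacc (ε / 2) (half_pos hε)
    refine ⟨Ψ (ψ * χ), ⟨hεU ?_, ψ * χ, mul_mem hψ hχ, rfl⟩, fun h => hχ1 ?_⟩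
    · refine lt_of_le_of_lt ((dist_le (half_pos hε).le).2 fun k => ?_) (half_lt_self hε)
      rw [dist_characterValues_apply, ← PontryaginDual.norm_coe_sub_one, inv_mul_cancel_left]
      exact hχε k
    · exact mul_eq_left.1 (hinj h)
  obtain ⟨F, hFsub, hFcont, hFinj⟩ := hperf.exists_nat_bool_injection ⟨Ψ 1, 1, one_mem _, rfl⟩
  have hsep : TopologicalSpace.SeparableSpace (range F) :=
    (TopologicalSpace.isSeparable_range hFcont).separableSpace
  have hunc' : Uncountable (ℕ → Bool) := by
    rw [← Cardinal.aleph0_lt_mk_iff]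
    simpa using Cardinal.aleph0_lt_continuum
  have hunc : Uncountable (range F) := (Equiv.ofInjective F hFinj).injective.uncountable
  choose f hfA hfΨ using fun y : range F => hFsub y.2
  have hf : Function.Injective f := fun y z h =>
    Subtype.ext ((hfΨ y).symm.trans ((congrArg Ψ h).trans (hfΨ z)))
  have hdist : ∀ k y z, c k * ‖(f y (γ k) : ℂ) - (f z (γ k) : ℂ)‖ ≤ dist y z := by
    intro k y z
    rw [← dist_characterValues_apply γ hc0 hc1, Subtype.dist_eq, ← hfΨ y, ← hfΨ z]
    exact dist_coe_le_dist k
  refine not_isJamisonSequence_of_lipschitz hf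
    (exists_lipschitz_of_closure_eq_top hγ fun k => ?_) fun k y z => ?_
  · refine ⟨(c k)⁻¹, (inv_pos.2 (hc0 k)).le, fun y z => ?_⟩
    rw [inv_mul_eq_div, le_div_iff₀' (hc0 k)]
    exact hdist k y z
  · rcases hg k with h | ⟨j, hj, hcj⟩
    · rw [hfA y _ h, hfA z _ h, sub_self, norm_zero]
      exact dist_nonneg
    · have := hdist j y z
      rwa [hcj, one_mul, ← hj] at this

end CantorSet

/-! ### Jamison sequences -/

section Jamison

variable {G : Type u}

theorem range_prependSeq {n : ℕ} (h : Fin n → G) (g : ℕ → G) :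
    range (prependSeq h g) = range h ∪ range g := by
  ext x
  constructor
  · rintro ⟨k, rfl⟩
    by_cases hk : k < n
    · exact Or.inl ⟨⟨k, hk⟩, by simp [prependSeq, hk]⟩
    · exact Or.inr ⟨k - n, by simp [prependSeq, hk]⟩
  · rintro (⟨i, rfl⟩ | ⟨k, rfl⟩)
    · exact ⟨i, by simp [prependSeq]⟩
    · exact ⟨k + n, by simp [prependSeq]⟩

variable [CommGroup G]

theorem generatedSubgroup_prependSeq {n : ℕ} {h : Fin n → G} {g : ℕ → G}
    (hh : IsCosetSystem (generatedSubgroup g) h) : generatedSubgroup (prependSeq h g) = ⊤ := by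
  have hle : range h ∪ range g ⊆ generatedSubgroup (prependSeq h g) := by
    rw [← range_prependSeq]
    exact Subgroup.subset_closure
  rw [eq_top_iff]
  intro x _
  obtain ⟨i, hi⟩ := hh.2 (x : G ⧸ generatedSubgroup g)
  have hx : (h i)⁻¹ * x ∈ generatedSubgroup g := QuotientGroup.eq.1 hi
  have hx' : (h i)⁻¹ * x ∈ generatedSubgroup (prependSeq h g) :=
    (Subgroup.closure_le _).2 (subset_union_right.trans hle) hx
  have := mul_mem (hle (Or.inl (mem_range_self i))) hx'
  rwa [mul_inv_cancel_left] at this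

theorem exists_isCosetSystem (H : Subgroup G) [Finite (G ⧸ H)] :
    ∃ h : Fin H.index → G, IsCosetSystem H h := by
  refine ⟨fun i => ((Finite.equivFinOfCardEq (rfl : Nat.card (G ⧸ H) = H.index)).symm i).out, ?_⟩
  simp only [IsCosetSystem, QuotientGroup.out_eq']
  exact Equiv.bijective _

variable [TopologicalSpace G]

/-- A sequence generating a subgroup of infinite index is not a Jamison sequence. The distance on
the characters trivial on the subgroup takes into account all elements of `G`, with
coefficients tending to `0`, so that it describes pointwise convergence. -/
theorem not_isJamisonSequence_of_infinite_quotient [DiscreteTopology G] [Countable G] [Infinite G]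
    {g : ℕ → G} (hQ : Infinite (G ⧸ generatedSubgroup g)) : ¬ IsJamisonSequence.{u, v} g := by
  obtain ⟨γ, hγ⟩ := exists_surjective_nat G
  refine not_isJamisonSequence_of_accPt (generatedSubgroup g) (γ := γ)
    (c := fun k => (1 / 2) ^ k) (by rw [hγ.range_eq, Subgroup.closure_univ])
    (fun k => by positivity) (fun k => pow_le_one₀ (by norm_num) (by norm_num)) ?_
    fun k => Or.inl (Subgroup.subset_closure (mem_range_self k))
  intro ε hε
  -- Values at late terms of the enumeration are multiplied by at most `ε / 2`, and a character
  -- is at distance at most `2` from `1`; only the first `N` terms have to be controlled.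
  obtain ⟨N, hN⟩ := exists_pow_lt_of_lt_one (half_pos hε) (one_half_lt_one (α := ℝ))
  classical
  obtain ⟨χ, hχ, hχ1, hχε⟩ := exists_mem_dualAnnihilator_forall_norm_lt (generatedSubgroup g)
    ((Finset.range N).image γ) hε
  refine ⟨χ, hχ, hχ1, fun k => ?_⟩
  have hck : ((1 : ℝ) / 2) ^ k ≤ 1 := pow_le_one₀ (by norm_num) (by norm_num)
  rcases lt_or_ge k N with hk | hk
  · have h := (hχε (γ k) (Finset.mem_image_of_mem γ (Finset.mem_range.2 hk))).le
    exact (mul_le_mul hck h (norm_nonneg _) zero_le_one).trans_eq (one_mul ε)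
  · have h : ((1 : ℝ) / 2) ^ k ≤ ε / 2 :=
      (pow_le_pow_of_le_one (by norm_num) (by norm_num) hk).trans hN.le
    exact (mul_le_mul h (PontryaginDual.norm_sub_one_le χ (γ k)) (norm_nonneg _)
      (half_pos hε).le).trans_eq (div_mul_cancel₀ ε two_ne_zero)

/-- Along a generating sequence, if the trivial character is not isolated for uniform convergence
along the sequence, then the sequence is not a Jamison sequence. -/
theorem not_isJamisonSequence_of_forall_exists [DiscreteTopology G] [Countable G] [Infinite G]
    {g : ℕ → G} (hgen : generatedSubgroup g = ⊤)
    (h : ∀ ε > 0, ∃ χ : PontryaginDual G, χ ≠ 1 ∧ ∀ k, ‖(χ (g k) : ℂ) - 1‖ ≤ ε) :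
    ¬ IsJamisonSequence.{u, v} g := by
  refine not_isJamisonSequence_of_accPt ⊥ hgen (c := fun _ => 1) (fun _ => one_pos)
    (fun _ => le_rfl) (fun ε hε => ?_) fun k => Or.inr ⟨k, rfl, rfl⟩
  obtain ⟨χ, hχ1, hχ⟩ := h ε hε
  refine ⟨χ, fun x hx => ?_, hχ1, fun k => (one_mul _).trans_le (hχ k)⟩
  rw [Subgroup.mem_bot.1 hx, map_one]

/-- If the nontrivial characters are uniformly separated from the trivial one along `g`, then `g`
is a Jamison sequence: unit eigenvectors for distinct characters are uniformly separated, and a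
separable space contains only countably many such vectors. -/
theorem isJamisonSequence_of_forall_le_iSup {g : ℕ → G} {ε : ℝ} (hε : 0 < ε)
    (h : ∀ χ : PontryaginDual G, χ ≠ 1 → ε ≤ ⨆ k : ℕ, ‖(χ (g k) : ℂ) - 1‖) :
    IsJamisonSequence.{u, v} g := by
  intro X _ _ _ _ _ ρ ⟨M, hM⟩
  have hM' : ∀ k, ‖(ρ (g k) : X →L[ℂ] X)‖ ≤ M := fun k => hM (mem_range_self k)
  have hM0 : 0 ≤ M := (norm_nonneg _).trans (hM' 0)
  have hunit : ∀ χ ∈ unimodularPointSpectrum ρ,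
      ∃ e : X, ‖e‖ = 1 ∧ ∀ x, (ρ x : X →L[ℂ] X) e = (χ x : ℂ) • e := by
    rintro χ ⟨e, he, heq⟩
    refine ⟨((‖e‖⁻¹ : ℝ) : ℂ) • e, ?_, fun x => ?_⟩
    · rw [norm_smul, Complex.norm_real, norm_inv, norm_norm,
        inv_mul_cancel₀ (norm_ne_zero_iff.2 he)]
    · rw [map_smul, heq, smul_comm]
  choose! e he heq using hunit
  have hsep : ∀ χ ∈ unimodularPointSpectrum ρ, ∀ ψ ∈ unimodularPointSpectrum ρ, χ ≠ ψ →
      ε / (M + 1) ≤ dist (e χ) (e ψ) := by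
    intro χ hχ ψ hψ hne
    rw [div_le_iff₀' (by positivity)]
    refine (h (ψ⁻¹ * χ) fun h1 => hne (inv_mul_eq_one.1 h1).symm).trans (ciSup_le fun k => ?_)
    rw [PontryaginDual.norm_coe_sub_one]
    have key : ((χ (g k) : ℂ) - (ψ (g k) : ℂ)) • e χ =
        (ρ (g k) : X →L[ℂ] X) (e χ - e ψ) - (ψ (g k) : ℂ) • (e χ - e ψ) := by
      rw [map_sub, heq χ hχ, heq ψ hψ, sub_smul, smul_sub]
      abel
    have hn : ‖(χ (g k) : ℂ) - (ψ (g k) : ℂ)‖ =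
        ‖((χ (g k) : ℂ) - (ψ (g k) : ℂ)) • e χ‖ := by
      rw [norm_smul, he χ hχ, mul_one]
    rw [hn, key, dist_eq_norm, add_mul]
    refine (norm_sub_le _ _).trans (add_le_add ?_ (le_of_eq ?_))
    · exact ContinuousLinearMap.le_of_opNorm_le _ (hM' k) _
    · rw [norm_smul, Circle.norm_coe]
  have hr : 0 < ε / (M + 1) / 2 := by positivity
  refine PairwiseDisjoint.countable_of_isOpen
    (s := fun χ => Metric.ball (e χ) (ε / (M + 1) / 2)) ?_ (fun _ _ => Metric.isOpen_ball)
    fun _ _ => Metric.nonempty_ball.2 hr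
  intro χ hχ ψ hψ hne
  exact Metric.ball_disjoint_ball (by rw [add_halves]; exact hsep χ hχ ψ hψ hne)

/-- Prepending finitely many terms does not affect the boundedness of a representation along a
sequence. -/
theorem isPartiallyBounded_prependSeq_iff {X : Type v} [NormedAddCommGroup X] [NormedSpace ℂ X]
    (ρ : G →ₜ* (X →L[ℂ] X)ˣ) {n : ℕ} (h : Fin n → G) (g : ℕ → G) :
    IsPartiallyBounded ρ (prependSeq h g) ↔ IsPartiallyBounded ρ g := by
  have hcomp : ∀ {ι : Type} (s : ι → G), range (fun i => ‖(ρ (s i) : X →L[ℂ] X)‖) =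
      (fun x => ‖(ρ x : X →L[ℂ] X)‖) '' range s := fun s =>
    range_comp (fun x => ‖(ρ x : X →L[ℂ] X)‖) s
  rw [IsPartiallyBounded, IsPartiallyBounded, hcomp, hcomp, range_prependSeq, image_union,
    bddAbove_union]
  exact and_iff_right ((finite_range h).image _).bddAbove

end Jamison

theorem mainTheorem1 {G : Type u} [CommGroup G] [TopologicalSpace G] [DiscreteTopology G]
    [Countable G] [Infinite G] (g : ℕ → G) :
    (Infinite (G ⧸ generatedSubgroup g) → ¬ IsJamisonSequence.{u, v} g) ∧
    (Finite (G ⧸ generatedSubgroup g) →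
      (∃ h : Fin (generatedSubgroup g).index → G, IsCosetSystem (generatedSubgroup g) h) ∧
      (∀ h : Fin (generatedSubgroup g).index → G, IsCosetSystem (generatedSubgroup g) h →
        generatedSubgroup (prependSeq h g) = ⊤ ∧
        (IsJamisonSequence.{u, v} g ↔ IsJamisonSequence.{u, v} (prependSeq h g))) ∧
      (generatedSubgroup g = ⊤ →
        (IsJamisonSequence.{u, v} g ↔
          ∃ ε : ℝ, 0 < ε ∧ ∀ χ : PontryaginDual G, χ ≠ 1 →
            ε ≤ ⨆ k : ℕ, ‖(χ (g k) : ℂ) - 1‖))) := by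
  refine ⟨not_isJamisonSequence_of_infinite_quotient, fun hfin =>
    ⟨exists_isCosetSystem _, fun h hh => ⟨generatedSubgroup_prependSeq hh, ?_⟩, fun hgen =>
      ⟨fun hJ => ?_, fun ⟨ε, hε, h⟩ => isJamisonSequence_of_forall_le_iSup hε h⟩⟩⟩
  · simp only [IsJamisonSequence, isPartiallyBounded_prependSeq_iff]
  · by_contra! hcon
    refine not_isJamisonSequence_of_forall_exists hgen (fun ε hε => ?_) hJ
    obtain ⟨χ, hχ1, hχ⟩ := hcon ε hε
    refine ⟨χ, hχ1, fun k => (le_ciSup (f := fun k => ‖(χ (g k) : ℂ) - 1‖) ⟨2, ?_⟩ k).trans hχ.le⟩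
    rintro _ ⟨k, rfl⟩
    exact PontryaginDual.norm_sub_one_le χ (g k)
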